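/- Let $X$ be a complex Banach space with bidual $X^{**}$. For an open set $U\subset X$, a $U$-bounded set is a bounded set $A\subset U$ whose distance to the boundary of $U$ is positive (the distance to an empty boundary being $+\infty$). Let $H_b(U)$ be the algebra of all holomorphic functions $f:U\to\mathbb C$ that are bounded on every $U$-bounded set, with the topology of uniform convergence on $U$-bounded sets, and let $\mathcal M(H_b(U))$ be the set of its continuous nonzero homomorphisms $\varphi:H_b(U)\to\mathbb C$. For a $U$-bounded set $A$, $z\in X^{**}$ and $f\in H_b(U)$ put $$\mathcal M_{z,A}(H_b(U))=\{\varphi\in\mathcal M(H_b(U)) : \varphi(x^*|_U)=z(x^*)\ \text{for all } x^*\in X^*,\ |\varphi(g)|\le\sup_A|g|\ \text{for all } g\in H_b(U)\},$$ $$Cl_A(f,z)=\{\lambda\in\mathbb C : \text{there is a net } (x_\alpha)\subset A \text{ with } x_\alpha\to z \text{ in } \sigma(X^{**},X^*) \text{ and } f(x_\alpha)\to\lambda\}.$$ The Cluster Value Theorem is said to hold for $H_b(U)$ if $$\{\varphi(f):\varphi\in\mathcal M_{z,A}(H_b(U))\}=Cl_A(f,z)$$ for every $f\in H_b(U)$,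 every $z\in X^{**}$ and every $U$-bounded set $A$. For a family $\mathcal A$ of subsets of $X$, it is said to hold for $H_b(U)$ with respect to $\mathcal A$ if this equality holds for every $f\in H_b(U)$, every $z\in X^{**}$ and every $U$-bounded set $A$ that belongs to $\mathcal A$. A set $U$ is balanced if $\lambda U\subset U$ whenever $\lambda\in\mathbb C$, $|\lambda|\le 1$. **Theorem.** The following are equivalent: 1. the Cluster Value Theorem holds for $H_b(X)$; 2. the Cluster Value Theorem holds for $H_b(U)$ for every nonempty balanced open set $U\subset X$; 3. the Cluster Value Theorem holds for $H_b(U)$ for some nonempty balanced open set $U\subset X$. Moreover, let $\mathcal A$ be any family of subsets of $X$ such that $rA\in\mathcal A$ for all $A\in\mathcal A$ and $r>0$ (for example, the closed balls centred at $0$, or the absolutely convex sets). Then 1, 2 and 3 are also equivalent when "the Cluster Value Theorem holds" is replaced throughout by "the Cluster Value Theorem holds with respect to $\mathcal A$". -/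

import Mathlib

open scoped ENNReal Topology

namespace ClusterValue

open TopologicalSpace Filter

section Defs

universe u

variable {X : Type u} [NormedAddCommGroup X] [NormedSpace ℂ X]

/-- `A` is a `U`-bounded set: a bounded subset of `U` whose distance to the boundary of `U` is
positive (the distance to an empty boundary being infinite). -/
def IsUBounded (U : Opens X) (A : Set X) : Prop :=
  Bornology.IsBounded A ∧ A ⊆ (U : Set X) ∧
    ∃ δ : ℝ, 0 < δ ∧ ∀ x ∈ A, ∀ y ∈ frontier (U : Set X), δ ≤ dist x y

/-- The algebra, under pointwise operations, of the complex valued functions on `U` that are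
holomorphic (complex Fréchet differentiable at every point of the open set `U`) and bounded on
every `U`-bounded set. Functions live on the subtype `U`; holomorphy is expressed through an
arbitrary extension to `X`, the values of which outside the open set `U` are irrelevant. -/
noncomputable def HbSubalgebra (U : Opens X) : Subalgebra ℂ (U → ℂ) where
  carrier := {f | (∃ g : X → ℂ, DifferentiableOn ℂ g (U : Set X) ∧ ∀ x : U, f x = g x) ∧
    ∀ A : Set X, IsUBounded U A → ∃ C : ℝ, ∀ x : U, (x : X) ∈ A → ‖f x‖ ≤ C}
  mul_mem' := by
    rintro f₁ f₂ ⟨⟨g₁, hg₁, h₁⟩, hb₁⟩ ⟨⟨g₂, hg₂, h₂⟩, hb₂⟩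
    refine ⟨⟨fun x => g₁ x * g₂ x, hg₁.mul hg₂, fun x => by simp [h₁, h₂]⟩, fun A hA => ?_⟩
    obtain ⟨C₁, hC₁⟩ := hb₁ A hA
    obtain ⟨C₂, hC₂⟩ := hb₂ A hA
    refine ⟨C₁ * C₂, fun x hx => ?_⟩
    rw [Pi.mul_apply, norm_mul]
    exact mul_le_mul (hC₁ x hx) (hC₂ x hx) (norm_nonneg _) ((norm_nonneg _).trans (hC₁ x hx))
  add_mem' := by
    rintro f₁ f₂ ⟨⟨g₁, hg₁, h₁⟩, hb₁⟩ ⟨⟨g₂, hg₂, h₂⟩, hb₂⟩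
    refine ⟨⟨fun x => g₁ x + g₂ x, hg₁.add hg₂, fun x => by simp [h₁, h₂]⟩, fun A hA => ?_⟩
    obtain ⟨C₁, hC₁⟩ := hb₁ A hA
    obtain ⟨C₂, hC₂⟩ := hb₂ A hA
    exact ⟨C₁ + C₂, fun x hx => (norm_add_le _ _).trans (add_le_add (hC₁ x hx) (hC₂ x hx))⟩
  algebraMap_mem' c :=
    ⟨⟨fun _ => c, differentiableOn_const c, fun _ => rfl⟩, fun _ _ => ⟨‖c‖, fun _ _ => le_rfl⟩⟩

/-- `H_b(U)`: the holomorphic functions of bounded type on `U`. This is a type of its own, so that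
it does not inherit the topology of pointwise convergence. -/
noncomputable def Hb (U : Opens X) : Type u := HbSubalgebra U

noncomputable instance (U : Opens X) : CommRing (Hb U) := inferInstanceAs (CommRing (HbSubalgebra U))

noncomputable instance (U : Opens X) : Algebra ℂ (Hb U) := inferInstanceAs (Algebra ℂ (HbSubalgebra U))

instance (U : Opens X) : CoeFun (Hb U) (fun _ => U → ℂ) := ⟨fun f => f.1⟩

/-- The topology of `H_b(U)`: uniform convergence on `U`-bounded sets. -/
noncomputable instance (U : Opens X) : TopologicalSpace (Hb U) :=
  TopologicalSpace.induced
    (fun f => UniformOnFun.ofFun {S : Set U | IsUBounded U (Subtype.val '' S)} (fun x => f x))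
    inferInstance

/-- A continuous linear functional on `X`, restricted to `U`, as an element of `H_b(U)`. -/
noncomputable def Hb.ofDual (U : Opens X) (ξ : StrongDual ℂ X) : Hb U :=
  ⟨fun x => ξ x, ⟨ξ, ξ.differentiable.differentiableOn, fun _ => rfl⟩, fun A hA => by
    obtain ⟨C, hC⟩ := hA.1.exists_norm_le
    exact ⟨‖ξ‖ * C, fun x hx => (ξ.le_opNorm x).trans
      (mul_le_mul_of_nonneg_left (hC x hx) (norm_nonneg _))⟩⟩

/-- The supremum of `|f|` over `A`, as an extended nonnegative real. -/
noncomputable def supNormOn {U : Opens X} (A : Set X) (f : Hb U) : ℝ≥0∞ :=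
  ⨆ (x : U) (_ : (x : X) ∈ A), ‖f x‖ₑ

/-- The spectrum of `H_b(U)`: its continuous nonzero complex homomorphisms. -/
abbrev Spectrum (U : Opens X) : Set (WeakDual ℂ (Hb U)) := WeakDual.characterSpace ℂ (Hb U)

/-- The `A`-fiber of the spectrum of `H_b(U)` over `z` in the bidual: the `φ` in the spectrum whose
restriction to the dual of `X` is `z` and which satisfy `|φ f| ≤ sup_A |f|` for all `f`. -/
def fiber (U : Opens X) (A : Set X) (z : StrongDual ℂ (StrongDual ℂ X)) :
    Set (WeakDual ℂ (Hb U)) :=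
  {φ | φ ∈ Spectrum U ∧ (∀ ξ : StrongDual ℂ X, φ (Hb.ofDual U ξ) = z ξ) ∧
    ∀ f : Hb U, ‖φ f‖ₑ ≤ supNormOn A f}

/-- The cluster set `Cl_A(f, z)`: the limits of the values of `f` along nets (here: nontrivial
filters) in `A` that converge to `z` in the weak-star topology of the bidual. -/
def clusterSet {U : Opens X} (A : Set X) (f : Hb U) (z : StrongDual ℂ (StrongDual ℂ X)) : Set ℂ :=
  {l | ∃ F : Filter U, F.NeBot ∧ (∀ᶠ x : U in F, (x : X) ∈ A) ∧
    Tendsto (fun x : U =>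
      StrongDual.toWeakDual (NormedSpace.inclusionInDoubleDual ℂ X (x : X))) F
      (𝓝 (StrongDual.toWeakDual z)) ∧
    Tendsto (fun x : U => f x) F (𝓝 l)}

/-- The equality of the image of the `A`-fiber over `z` under the Gelfand transform of `f` with the
cluster set `Cl_A(f, z)`, for all `f` and `z`. -/
def ClusterValueEqOn (U : Opens X) (A : Set X) : Prop :=
  ∀ (f : Hb U) (z : StrongDual ℂ (StrongDual ℂ X)),
    (fun φ : WeakDual ℂ (Hb U) => φ f) '' fiber U A z = clusterSet A f z

/-- The Cluster Value Theorem holds for `H_b(U)`. -/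
def ClusterValueTheorem (U : Opens X) : Prop :=
  ∀ A : Set X, IsUBounded U A → ClusterValueEqOn U A

/-- The Cluster Value Theorem holds for `H_b(U)` with respect to the sets of the family `𝒜`. -/
def ClusterValueTheoremFor (𝒜 : Set (Set X)) (U : Opens X) : Prop :=
  ∀ A ∈ 𝒜, IsUBounded U A → ClusterValueEqOn U A

/-- A family of subsets of `X` that is stable under dilations by positive factors. -/
def DilationStable (𝒜 : Set (Set X)) : Prop :=
  ∀ A ∈ 𝒜, ∀ r : ℝ, 0 < r → (fun x : X => (r : ℂ) • x) '' A ∈ 𝒜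

end Defs

end ClusterValue

/-! Fix a balanced open `U` containing `0` and a `U`-bounded set `A`. A slight dilation of `A` by a
factor `R > 1`, together with its balanced hull, is still `U`-bounded
(`IsUBounded.exists_dilation`). Cauchy's estimates on discs of radius `R` therefore make the Taylor
polynomials at `0` of any `f ∈ H_b(U)` converge to `f` geometrically on `A`. These polynomials are
entire of bounded type, so `H_b(X)` is dense in `H_b(U)` for the seminorm `sup_A`
(`exists_entire_approx`).

Hence characters dominated by `sup_A` correspond: those of `H_b(U)` compose with restriction, and
those of `H_b(X)` extend by continuity (`exists_algHom_extension`). Both passages preserve the point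
`z` of the bidual. Cluster sets over `A` are stable under uniform approximation on `A`, so the
cluster value equality for `A` is the same in `H_b(U)` and in `H_b(X)` (`clusterValueEqOn_iff_top`).

A bounded set need not lie in `U`, but a small multiple of it is `U`-bounded, and dilations are
automorphisms of `H_b(X)` that transport fibers and cluster sets (`ClusterValueEqOn.of_smul`). This
is the only place where stability of the family under dilations enters. -/

namespace ClusterValue

open TopologicalSpace Filter

/-! ### Holomorphic functions on normed spaces and their Taylor expansions at the origin -/

section Holomorphic

open Metric Set

variable {X : Type*} [NormedAddCommGroup X] [NormedSpace ℂ X]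

/-- Cauchy's estimate for the Fréchet derivative of a bounded holomorphic function on a ball. -/
theorem norm_fderiv_le_of_norm_le {g : X → ℂ} {c : X} {r C : ℝ} (hr : 0 < r)
    (hg : DifferentiableOn ℂ g (ball c r)) (hC : ∀ x ∈ ball c r, ‖g x‖ ≤ C) :
    ‖fderiv ℂ g c‖ ≤ 2 * C / r := by
  -- The estimate is in terms of the oscillation `g x - g c`, which is at most `2 * C`.
  refine Complex.norm_fderiv_le_div_of_mapsTo_ball hg (fun x hx => ?_) hr
  rw [mem_closedBall, dist_eq_norm]
  linarith [norm_sub_le (g x) (g c), hC x hx, hC c (mem_ball_self hr)]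

/-- The uniform limit of holomorphic functions on a ball is holomorphic, in any complex normed
space. -/
theorem differentiableOn_ball_of_tendstoUniformlyOn {ι : Type*} {l : Filter ι} [l.NeBot]
    {F : ι → X → ℂ} {f : X → ℂ} {c : X} {r : ℝ}
    (hF : ∀ᶠ i in l, DifferentiableOn ℂ (F i) (ball c r))
    (h : TendstoUniformlyOn F f l (ball c r)) : DifferentiableOn ℂ f (ball c r) := by
  intro x hx
  obtain ⟨s, hs, hsub⟩ : ∃ s > 0, ball x (s + s) ⊆ ball c r := by
    obtain ⟨s, hs, h⟩ := Metric.isOpen_iff.1 isOpen_ball x hx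
    exact ⟨s / 2, by positivity, by simpa using h⟩
  have hcauchy : UniformCauchySeqOn (fun i => fderiv ℂ (F i)) l (ball x s) := by
    intro u hu
    obtain ⟨ε, hε, hu⟩ := Metric.mem_uniformity_dist.1 hu
    -- Cauchy's estimate on balls of radius `s` turns a bound `ε * s / 4` for the difference of two
    -- functions into `ε / 2` for the difference of their derivatives.
    have h1 := h.uniformCauchySeqOn _ (Metric.dist_mem_uniformity (show 0 < ε * s / 4 by positivity))
    filter_upwards [h1, prod_mem_prod hF hF] with p hp hd y hy
    refine hu ?_
    have hys : ball y s ⊆ ball c r :=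
      (ball_subset_ball' (by linarith [mem_ball.1 hy])).trans hsub
    have hdy : ∀ i, DifferentiableOn ℂ (F i) (ball c r) → DifferentiableAt ℂ (F i) y :=
      fun i hi => hi.differentiableAt (isOpen_ball.mem_nhds (hys (mem_ball_self hs)))
    rw [dist_eq_norm, ← fderiv_sub (hdy _ hd.1) (hdy _ hd.2)]
    have hb := norm_fderiv_le_of_norm_le (C := ε * s / 4) hs ((hd.1.sub hd.2).mono hys)
      (fun z hz => by simpa [dist_eq_norm] using (hp z (hys hz)).le)
    refine hb.trans_lt ?_
    rw [div_lt_iff₀ hs]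
    linarith [mul_pos hε hs]
  have hlim : ∀ y ∈ ball x s, ∃ L, Tendsto (fun i => fderiv ℂ (F i) y) l (𝓝 L) := by
    intro y hy
    -- The derivatives lie in the dual of `X`, which is complete because `ℂ` is.
    exact cauchy_map_iff_exists_tendsto.1 (hcauchy.cauchy_map hy)
  choose! L hL using hlim
  have hunif := hcauchy.tendstoUniformlyOn_of_tendsto hL
  have hball : ball x s ∈ 𝓝 x := ball_mem_nhds x hs
  have hsub' : ball x s ⊆ ball c r := (ball_subset_ball (by linarith)).trans hsub
  refine (hasFDerivAt_of_tendstoUniformlyOnFilter (l := l) (f := F) (g := f) (g' := L)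
    (f' := fun i => fderiv ℂ (F i)) (x := x) ?_ ?_ ?_).differentiableAt.differentiableWithinAt
  · exact (tendstoUniformlyOn_iff_tendstoUniformlyOnFilter.1 hunif).mono_right
      (le_principal_iff.2 hball)
  · filter_upwards [prod_mem_prod hF hball] with p hp
    exact ((hp.1 p.2 (hsub' hp.2)).differentiableAt
      (isOpen_ball.mem_nhds (hsub' hp.2))).hasFDerivAt
  · filter_upwards [hball] with y hy using h.tendsto_at (hsub' hy)

/-- The value at `x` of the `k`-th homogeneous polynomial of the Taylor expansion of `g` at `0`. -/
noncomputable def taylorCoeff (g : X → ℂ) (k : ℕ) (x : X) : ℂ :=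
  (k.factorial : ℂ)⁻¹ * iteratedDeriv k (fun t : ℂ => g (t • x)) 0

variable {g : X → ℂ} {U : Set X} {x : X} {R C : ℝ}

theorem differentiableOn_comp_smul (hg : DifferentiableOn ℂ g U) {s : Set ℂ}
    (hx : ∀ t ∈ s, t • x ∈ U) : DifferentiableOn ℂ (fun t : ℂ => g (t • x)) s :=
  hg.comp (by fun_prop) hx

theorem norm_taylorCoeff_le (hg : DifferentiableOn ℂ g U) (hR : 0 < R)
    (hx : ∀ t : ℂ, ‖t‖ ≤ R → t • x ∈ U) (hC : ∀ t : ℂ, ‖t‖ ≤ R → ‖g (t • x)‖ ≤ C) (k : ℕ) :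
    ‖taylorCoeff g k x‖ ≤ C / R ^ k := by
  have hd : DiffContOnCl ℂ (fun t : ℂ => g (t • x)) (ball 0 R) := by
    refine DifferentiableOn.diffContOnCl ?_
    rw [closure_ball _ hR.ne']
    exact differentiableOn_comp_smul hg fun t ht => hx t (by simpa using ht)
  have h := Complex.norm_iteratedDeriv_le_of_forall_mem_sphere_norm_le k hR hd
    (fun t ht => hC t (by simpa using (mem_sphere_zero_iff_norm.1 ht).le))
  have hk : (0 : ℝ) < k.factorial := by positivity
  rw [taylorCoeff, norm_mul, norm_inv, Complex.norm_natCast, inv_mul_le_iff₀ hk]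
  exact h.trans_eq (mul_div_assoc _ _ _)

theorem hasSum_taylorCoeff (hg : DifferentiableOn ℂ g U)
    (hx : ∀ t : ℂ, ‖t‖ ≤ R → t • x ∈ U) {t : ℂ} (ht : ‖t‖ < R) :
    HasSum (fun k => taylorCoeff g k x * t ^ k) (g (t • x)) := by
  have h := Complex.hasSum_taylorSeries_on_ball (c := 0) (r := R)
    (differentiableOn_comp_smul (x := x) hg fun t ht => hx t
      (by simpa using (mem_ball_zero_iff.1 ht).le))
    (mem_ball_zero_iff.2 ht)
  refine (funext fun k => ?_ : (fun k => taylorCoeff g k x * t ^ k) = _) ▸ h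
  simp only [taylorCoeff, sub_zero, smul_eq_mul]
  ring

/-- The remainder of the Taylor expansion at `0`. -/
theorem norm_sub_sum_taylorCoeff_le (hg : DifferentiableOn ℂ g U) (hR : 0 < R)
    (hx : ∀ t : ℂ, ‖t‖ ≤ R → t • x ∈ U) (hC : ∀ t : ℂ, ‖t‖ ≤ R → ‖g (t • x)‖ ≤ C)
    {t : ℂ} (ht : ‖t‖ < R) (n : ℕ) :
    ‖g (t • x) - ∑ k ∈ Finset.range n, taylorCoeff g k x * t ^ k‖ ≤
      C * (‖t‖ / R) ^ n / (1 - ‖t‖ / R) := by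
  rw [← dist_eq_norm, dist_comm]
  refine dist_le_of_le_geometric_of_tendsto
    (f := fun n => ∑ k ∈ Finset.range n, taylorCoeff g k x * t ^ k)
    (‖t‖ / R) C ((div_lt_one hR).2 ht) (fun k => ?_)
    (hasSum_taylorCoeff hg hx ht).tendsto_sum_nat n
  rw [Finset.sum_range_succ, dist_self_add_right, norm_mul, norm_pow, div_pow, ← mul_div_assoc,
    mul_div_right_comm]
  gcongr
  exact norm_taylorCoeff_le hg hR hx hC k

theorem exists_ball_norm_le (hU : IsOpen U) (h0 : (0 : X) ∈ U) (hg : DifferentiableOn ℂ g U) :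
    ∃ ρ > 0, ∃ C : ℝ, ∀ y : X, ‖y‖ ≤ ρ → y ∈ U ∧ ‖g y‖ ≤ C := by
  have hc : ContinuousAt g 0 := (hg.continuousOn).continuousAt (hU.mem_nhds h0)
  have h1 : ∀ᶠ y in 𝓝 (0 : X), y ∈ U ∧ ‖g y‖ < ‖g 0‖ + 1 :=
    (hU.eventually_mem h0).and (hc.norm.eventually_lt_const (lt_add_one _))
  obtain ⟨ρ, hρ, h⟩ := Metric.eventually_nhds_iff_ball.1 h1
  refine ⟨ρ / 2, by positivity, ‖g 0‖ + 1, fun y hy => ?_⟩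
  have := h y (by rw [mem_ball_zero_iff]; linarith)
  exact ⟨this.1, this.2.le⟩

/-- On a bounded set, the functions `t ↦ g (t • x)` are defined and bounded on a common disc. -/
theorem exists_disc_norm_le (hU : IsOpen U) (h0 : (0 : X) ∈ U) (hg : DifferentiableOn ℂ g U)
    (M : ℝ) : ∃ R > 0, ∃ C : ℝ, ∀ x : X, ‖x‖ ≤ M →
      ∀ t : ℂ, ‖t‖ ≤ R → t • x ∈ U ∧ ‖g (t • x)‖ ≤ C := by
  obtain ⟨ρ, hρ, C, h⟩ := exists_ball_norm_le hU h0 hg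
  refine ⟨ρ / (|M| + 1), by positivity, C, fun x hx t ht => h _ ?_⟩
  rw [norm_smul]
  calc ‖t‖ * ‖x‖ ≤ ρ / (|M| + 1) * (|M| + 1) := by
        gcongr
        linarith [le_abs_self M]
    _ = ρ := by field_simp

/-- The coefficient depends only on `g` near `0`, so Cauchy's estimate on a small disc controls it
on every bounded subset of `X`, including points outside `U`. -/
theorem exists_norm_taylorCoeff_le (hU : IsOpen U) (h0 : (0 : X) ∈ U)
    (hg : DifferentiableOn ℂ g U) (k : ℕ) (M : ℝ) :
    ∃ C : ℝ, ∀ x : X, ‖x‖ ≤ M → ‖taylorCoeff g k x‖ ≤ C := by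
  obtain ⟨R, hR, C, h⟩ := exists_disc_norm_le hU h0 hg M
  exact ⟨C / R ^ k, fun x hx => norm_taylorCoeff_le hg hR (fun t ht => (h x hx t ht).1)
    (fun t ht => (h x hx t ht).2) k⟩

/-- The `k`-th coefficient is the limit, as `t → 0`, of `g (t • x)` minus the terms of order below
`k`, divided by `t ^ k`. The limit is uniform for `x` in a ball about `0`, and by induction the
quotients are holomorphic in `x` there. -/
theorem differentiable_taylorCoeff (hU : IsOpen U) (h0 : (0 : X) ∈ U)
    (hg : DifferentiableOn ℂ g U) (k : ℕ) : Differentiable ℂ (taylorCoeff g k) := by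
  induction k using Nat.strong_induction_on with
  | _ k ih =>
    intro x₀
    set M := ‖x₀‖ + 1
    obtain ⟨R, hR, C, h⟩ := exists_disc_norm_le hU h0 hg M
    have hmem : ball (0 : X) M ∈ 𝓝 x₀ := isOpen_ball.mem_nhds (by simp [M])
    have hM : ∀ x ∈ ball (0 : X) M, ‖x‖ ≤ M := fun x hx => (mem_ball_zero_iff.1 hx).le
    have hC : 0 ≤ C := (norm_nonneg _).trans (h 0 (by simp [M]; positivity) 0 (by simpa using hR.le)).2
    refine (differentiableOn_ball_of_tendstoUniformlyOn (l := 𝓝[≠] (0 : ℂ))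
      (F := fun t x => (g (t • x) - ∑ j ∈ Finset.range k, taylorCoeff g j x * t ^ j) / t ^ k)
      ?_ ?_).differentiableAt hmem
    · have : ∀ᶠ t : ℂ in 𝓝[≠] 0, ‖t‖ < R :=
        eventually_nhdsWithin_of_eventually_nhds
          (continuous_norm.continuousAt.eventually_lt_const (by simpa using hR))
      filter_upwards [this] with t ht
      have hgt : DifferentiableOn ℂ (fun x => g (t • x)) (ball 0 M) :=
        hg.comp (by fun_prop) fun x hx => (h x (hM x hx) t ht.le).1
      simp only [div_eq_mul_inv]
      refine DifferentiableOn.mul_const (hgt.fun_sub ?_) _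
      exact DifferentiableOn.fun_sum fun j hj =>
        ((ih j (Finset.mem_range.1 hj)).differentiableOn).mul_const _
    · rw [Metric.tendstoUniformlyOn_iff]
      intro ε hε
      -- The remainder after the `k`-th term is at most `C * (‖t‖ / R) ^ (k + 1) / (1 - ‖t‖ / R)`.
      -- For `‖t‖ < R / 2` the denominator is at least `1 / 2`, and division by `‖t‖ ^ k` leaves
      -- this bound.
      have hlim : Tendsto (fun t : ℂ => C * 2 / R ^ (k + 1) * ‖t‖) (𝓝[≠] 0) (𝓝 0) := by
        refine Tendsto.mono_left ?_ nhdsWithin_le_nhds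
        exact Continuous.tendsto' (by fun_prop) _ _ (by simp)
      have hsmall : ∀ᶠ t : ℂ in 𝓝[≠] 0, ‖t‖ < R / 2 :=
        eventually_nhdsWithin_of_eventually_nhds
          (continuous_norm.continuousAt.eventually_lt_const (by simpa using hR))
      filter_upwards [hlim.eventually_lt_const hε, hsmall, self_mem_nhdsWithin] with t h1 h2 h3 x hx
      have ht0 : t ≠ 0 := h3
      have htp : 0 < ‖t‖ := norm_pos_iff.2 ht0
      refine lt_of_le_of_lt ?_ h1
      have hrem := norm_sub_sum_taylorCoeff_le hg hR (fun t ht => (h x (hM x hx) t ht).1)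
        (fun t ht => (h x (hM x hx) t ht).2) (t := t) (by linarith) (k + 1)
      rw [Finset.sum_range_succ, ← sub_sub] at hrem
      have heq : (g (t • x) - ∑ j ∈ Finset.range k, taylorCoeff g j x * t ^ j) / t ^ k
          - taylorCoeff g k x = (g (t • x) - ∑ j ∈ Finset.range k, taylorCoeff g j x * t ^ j
            - taylorCoeff g k x * t ^ k) / t ^ k := by
        field_simp
      rw [dist_comm, dist_eq_norm, heq, norm_div, norm_pow, div_le_iff₀ (by positivity)]
      refine hrem.trans ?_
      have hq : ‖t‖ / R ≤ 1 / 2 := by rw [div_le_iff₀ hR]; linarith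
      calc C * (‖t‖ / R) ^ (k + 1) / (1 - ‖t‖ / R)
          ≤ C * (‖t‖ / R) ^ (k + 1) / (1 / 2) := by
            gcongr
            linarith
        _ = _ := by rw [div_pow, pow_succ ‖t‖]; ring

end Holomorphic

/-! ### Fibers, cluster sets and the inclusion that always holds -/

section Fibers

variable {X : Type*} [NormedAddCommGroup X] [NormedSpace ℂ X] {U : Opens X} {A : Set X}

theorem Hb.ext {f g : Hb U} (h : ∀ x : U, f x = g x) : f = g :=
  Subtype.ext (funext h)

theorem Hb.add_apply (f g : Hb U) (x : U) : (f + g) x = f x + g x := rfl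

theorem Hb.sub_apply (f g : Hb U) (x : U) : (f - g) x = f x - g x := rfl

theorem enorm_le_supNormOn (f : Hb U) {x : U} (hx : (x : X) ∈ A) : ‖f x‖ₑ ≤ supNormOn A f :=
  le_iSup₂ (f := fun (x : U) (_ : (x : X) ∈ A) => ‖f x‖ₑ) x hx

theorem supNormOn_le {f : Hb U} {C : ℝ≥0∞} (h : ∀ x : U, (x : X) ∈ A → ‖f x‖ₑ ≤ C) :
    supNormOn A f ≤ C :=
  iSup₂_le h

theorem supNormOn_ne_top (hA : IsUBounded U A) (f : Hb U) : supNormOn A f ≠ ∞ := by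
  obtain ⟨C, hC⟩ := f.2.2 A hA
  refine ne_top_of_le_ne_top (ENNReal.ofReal_ne_top (r := C)) (supNormOn_le fun x hx => ?_)
  rw [← ofReal_norm]
  exact ENNReal.ofReal_le_ofReal (hC x hx)

theorem supNormOn_add_le (f g : Hb U) :
    supNormOn A (f + g) ≤ supNormOn A f + supNormOn A g :=
  supNormOn_le fun x hx => (enorm_add_le (f x) (g x)).trans
    (add_le_add (enorm_le_supNormOn f hx) (enorm_le_supNormOn g hx))

theorem supNormOn_sub_le (f g : Hb U) :
    supNormOn A (f - g) ≤ supNormOn A f + supNormOn A g :=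
  supNormOn_le fun x hx => (enorm_sub_le (E := ℂ) (a := f x) (b := g x)).trans
    (add_le_add (enorm_le_supNormOn f hx) (enorm_le_supNormOn g hx))

theorem supNormOn_mul_le (f g : Hb U) :
    supNormOn A (f * g) ≤ supNormOn A f * supNormOn A g :=
  supNormOn_le fun x hx => (enorm_mul (f x) (g x)).trans_le
    (mul_le_mul' (enorm_le_supNormOn f hx) (enorm_le_supNormOn g hx))

/-- An algebra homomorphism which satisfies `|φ f| ≤ sup_A |f|` for a `U`-bounded set `A` is
continuous. -/
theorem continuous_of_enorm_le_supNormOn (hA : IsUBounded U A) (φ : Hb U →ₐ[ℂ] ℂ)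
    (hφ : ∀ f, ‖φ f‖ₑ ≤ supNormOn A f) : Continuous φ := by
  rw [continuous_iff_continuousAt]
  intro f
  have h1 := (continuous_induced_dom (f := fun f : Hb U => UniformOnFun.ofFun
    {S : Set U | IsUBounded U (Subtype.val '' S)} (fun x => f x))).tendsto f
  have hS : (Subtype.val ⁻¹' A : Set U) ∈ {S : Set U | IsUBounded U (Subtype.val '' S)} := by
    have : Subtype.val '' (Subtype.val ⁻¹' A : Set U) = A :=
      (Subtype.image_preimage_coe (U : Set X) A).trans (Set.inter_eq_right.2 hA.2.1)
    rwa [Set.mem_ofPred_eq, this]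
  have h2 := UniformOnFun.tendsto_iff_tendstoUniformlyOn.1 h1 _ hS
  rw [ContinuousAt, EMetric.tendsto_nhds]
  intro ε hε
  obtain ⟨δ, hδ, hδε⟩ := exists_between hε
  filter_upwards [EMetric.tendstoUniformlyOn_iff.1 h2 δ hδ] with g hg
  refine lt_of_le_of_lt ?_ hδε
  rw [edist_eq_enorm_sub, ← map_sub]
  refine (hφ _).trans (supNormOn_le fun x hx => ?_)
  have := (hg x hx).le
  rw [edist_comm, edist_eq_enorm_sub] at this
  exact this

/-- The image of a fiber under the Gelfand transform of `f`, in terms of algebra homomorphisms whose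
continuity is automatic. -/
theorem mem_image_fiber_iff (hA : IsUBounded U A) {f : Hb U}
    {z : StrongDual ℂ (StrongDual ℂ X)} {l : ℂ} :
    l ∈ (fun φ : WeakDual ℂ (Hb U) => φ f) '' fiber U A z ↔
      ∃ φ : Hb U →ₐ[ℂ] ℂ, (∀ ξ, φ (Hb.ofDual U ξ) = z ξ) ∧ (∀ g, ‖φ g‖ₑ ≤ supNormOn A g) ∧
        φ f = l := by
  constructor
  · rintro ⟨φ, ⟨hφ, h1, h2⟩, rfl⟩
    exact ⟨WeakDual.CharacterSpace.toAlgHom ⟨φ, hφ⟩, h1, h2, rfl⟩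
  · rintro ⟨φ, h1, h2, rfl⟩
    let ψ : Hb U →L[ℂ] ℂ := ⟨φ.toLinearMap, continuous_of_enorm_le_supNormOn hA φ h2⟩
    refine ⟨StrongDual.toWeakDual ψ, ⟨?_, h1, h2⟩, rfl⟩
    rw [Spectrum, WeakDual.CharacterSpace.eq_set_map_one_map_mul]
    exact ⟨map_one φ, map_mul φ⟩

theorem mem_clusterSet_iff {f : Hb U} {z : StrongDual ℂ (StrongDual ℂ X)} {l : ℂ} :
    l ∈ clusterSet A f z ↔ ∃ F : Filter U, F.NeBot ∧ (∀ᶠ x : U in F, (x : X) ∈ A) ∧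
      (∀ ξ : StrongDual ℂ X, Tendsto (fun x : U => ξ x) F (𝓝 (z ξ))) ∧
      Tendsto (fun x : U => f x) F (𝓝 l) := by
  simp only [clusterSet, Set.mem_ofPred_eq, tendsto_iff_forall_eval_tendsto_topDualPairing]
  rfl

/-- Passing to ultrafilters makes membership a condition on neighbourhoods of `(z, l)`: each is hit
by some point of `A`. In this form an approximation argument needs only one point at a time. -/
theorem mem_clusterSet_iff_mapClusterPt {f : Hb U} {z : StrongDual ℂ (StrongDual ℂ X)} {l : ℂ} :
    l ∈ clusterSet A f z ↔ MapClusterPt (StrongDual.toWeakDual z, l)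
      (𝓟 (Subtype.val ⁻¹' A : Set U)) (fun x : U =>
        (StrongDual.toWeakDual (NormedSpace.inclusionInDoubleDual ℂ X (x : X)), f x)) := by
  rw [mapClusterPt_iff_ultrafilter]
  constructor
  · rintro ⟨F, hF, hA, hz, hl⟩
    refine ⟨Ultrafilter.of F, (Ultrafilter.of_le F).trans (le_principal_iff.2 hA), ?_⟩
    exact (hz.prodMk_nhds hl).mono_left (Ultrafilter.of_le F)
  · rintro ⟨F, hA, h⟩
    exact ⟨F, inferInstance, le_principal_iff.1 hA, (continuous_fst.tendsto _).comp h,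
      (continuous_snd.tendsto _).comp h⟩

/-- Cluster sets are stable under uniform approximation on `A`, also by functions on other open
sets. -/
theorem mem_clusterSet_of_forall_approx {V : Opens X} (hAU : A ⊆ U) {f : Hb U}
    {z : StrongDual ℂ (StrongDual ℂ X)} {l : ℂ}
    (h : ∀ ε : ℝ≥0∞, 0 < ε → ∃ (g : Hb V) (m : ℂ), m ∈ clusterSet A g z ∧ edist m l ≤ ε ∧
      ∀ (x : U) (y : V), (x : X) = y → (x : X) ∈ A → edist (f x) (g y) ≤ ε) :
    l ∈ clusterSet A f z := by
  rw [mem_clusterSet_iff_mapClusterPt,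
    ((𝓝 (StrongDual.toWeakDual z)).basis_sets.prod_nhds
      Metric.nhds_basis_eball).mapClusterPt_iff_frequently]
  rintro ⟨W, ε⟩ ⟨hW, hε : 0 < ε⟩
  have hε3 : 0 < ε / 3 := ENNReal.div_pos hε.ne' (by simp)
  obtain ⟨ε', hε', hlt⟩ := exists_between hε3
  obtain ⟨g, m, hm, hml, hfg⟩ := h ε' hε'
  rw [mem_clusterSet_iff_mapClusterPt,
    ((𝓝 (StrongDual.toWeakDual z)).basis_sets.prod_nhds
      Metric.nhds_basis_eball).mapClusterPt_iff_frequently] at hm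
  obtain ⟨y, hyA, hyW, hy⟩ := frequently_principal.1 (hm (W, ε / 3) ⟨hW, hε3⟩)
  refine frequently_principal.2 ⟨⟨y, hAU hyA⟩, hyA, hyW, ?_⟩
  have h1 := hfg ⟨y, hAU hyA⟩ y rfl hyA
  have h2 : edist (g y) m < ε / 3 := hy
  calc edist (f ⟨y, hAU hyA⟩) l ≤ edist (f ⟨y, hAU hyA⟩) (g y) + edist (g y) m + edist m l :=
        edist_triangle4 _ _ _ _
    _ < ε / 3 + ε / 3 + ε / 3 := by
        gcongr
        · exact h1.trans_lt hlt
        · exact hml.trans_lt hlt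
    _ = ε := ENNReal.add_thirds ε

/-- A functional relation which is compatible with the operations is an algebra homomorphism. -/
theorem exists_algHom_of_rel {B : Type*} [CommRing B] [Algebra ℂ B] {R : B → ℂ → Prop}
    (hex : ∀ b, ∃ c, R b c) (huniq : ∀ b c c', R b c → R b c' → c = c')
    (hadd : ∀ b b' c c', R b c → R b' c' → R (b + b') (c + c'))
    (hmul : ∀ b b' c c', R b c → R b' c' → R (b * b') (c * c'))
    (hC : ∀ c, R (algebraMap ℂ B c) c) : ∃ φ : B →ₐ[ℂ] ℂ, ∀ b, R b (φ b) := by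
  choose φ hφ using hex
  refine ⟨⟨⟨⟨⟨φ, ?_⟩, fun b b' => ?_⟩, ?_, fun b b' => ?_⟩, fun c => ?_⟩, hφ⟩
  · exact huniq _ _ _ (hφ _) (by simpa using hC 1)
  · exact huniq _ _ _ (hφ _) (hmul _ _ _ _ (hφ _) (hφ _))
  · exact huniq _ _ _ (hφ _) (by simpa using hC 0)
  · exact huniq _ _ _ (hφ _) (hadd _ _ _ _ (hφ _) (hφ _))
  · exact huniq _ _ _ (hφ _) (hC c)

/-- The inclusion in the Cluster Value Theorem which always holds. -/
theorem clusterSet_subset_image_fiber (hA : IsUBounded U A) (f : Hb U)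
    (z : StrongDual ℂ (StrongDual ℂ X)) :
    clusterSet A f z ⊆ (fun φ : WeakDual ℂ (Hb U) => φ f) '' fiber U A z := by
  intro l hl
  obtain ⟨F, hF, hFA, hFz, hFl⟩ := mem_clusterSet_iff.1 hl
  have hle := Ultrafilter.of_le F
  set 𝒰 := Ultrafilter.of F
  -- Each `g` is bounded on `A`, so by compactness its values converge along the ultrafilter. Taking
  -- this limit is the required homomorphism.
  obtain ⟨φ, hφ⟩ := exists_algHom_of_rel (B := Hb U)
    (R := fun g c => Tendsto (fun x : U => g x) 𝒰 (𝓝 c))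
    (fun g => by
      obtain ⟨C, hC⟩ := g.2.2 A hA
      have hmem : ∀ᶠ x : U in (𝒰 : Filter U), g x ∈ Metric.closedBall (0 : ℂ) C := by
        filter_upwards [hle hFA] with x hx
        simpa using hC x hx
      obtain ⟨c, -, hc⟩ := (isCompact_closedBall (0 : ℂ) C).ultrafilter_le_nhds
        (𝒰.map fun x : U => g x) (le_principal_iff.2 hmem)
      exact ⟨c, hc⟩)
    (fun _ _ _ => tendsto_nhds_unique) (fun _ _ _ _ => Tendsto.add) (fun _ _ _ _ => Tendsto.mul)
    (fun _ => tendsto_const_nhds)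
  refine (mem_image_fiber_iff hA).2 ⟨φ, fun ξ => ?_, fun g => ?_, ?_⟩
  · exact tendsto_nhds_unique (hφ _) ((hFz ξ).mono_left hle)
  · refine le_of_tendsto (hφ g).enorm ?_
    filter_upwards [hle hFA] with x hx using enorm_le_supNormOn g hx
  · exact tendsto_nhds_unique (hφ f) (hFl.mono_left hle)

/-- Only the inclusion of the fiber image in the cluster set is in question, and domination by the
supremum over `A` already gives continuity. -/
theorem clusterValueEqOn_iff (hA : IsUBounded U A) :
    ClusterValueEqOn U A ↔ ∀ (f : Hb U) (z : StrongDual ℂ (StrongDual ℂ X)) (φ : Hb U →ₐ[ℂ] ℂ),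
      (∀ ξ, φ (Hb.ofDual U ξ) = z ξ) → (∀ g, ‖φ g‖ₑ ≤ supNormOn A g) →
        φ f ∈ clusterSet A f z := by
  constructor
  · intro h f z φ h1 h2
    exact h f z ▸ (mem_image_fiber_iff hA).2 ⟨φ, h1, h2, rfl⟩
  · intro h f z
    refine Set.Subset.antisymm (fun l hl => ?_) (clusterSet_subset_image_fiber hA f z)
    obtain ⟨φ, h1, h2, rfl⟩ := (mem_image_fiber_iff hA).1 hl
    exact h f z φ h1 h2

end Fibers

/-! ### Geometry of bounded sets in balanced open sets -/

section Balanced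

open Metric Set

variable {X : Type*} [NormedAddCommGroup X] [NormedSpace ℂ X] {U : Opens X} {A : Set X}

/-- The ball misses the boundary, so it is covered by the disjoint open sets `U` and the complement
of `closure U`. Being connected and meeting `U` at its centre, it stays in `U`. -/
theorem IsUBounded.exists_ball_subset (hA : IsUBounded U A) :
    ∃ δ > 0, ∀ x ∈ A, ball x δ ⊆ (U : Set X) := by
  obtain ⟨-, hAU, δ, hδ, h⟩ := hA
  refine ⟨δ, hδ, fun x hx => ?_⟩
  have hpre : IsPreconnected (ball x δ) :=
    @Convex.isPreconnected X _ _ _ _ _ _ (convex_ball x δ)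
  refine hpre.subset_left_of_subset_union U.isOpen isClosed_closure.isOpen_compl
    (disjoint_compl_right.mono_left subset_closure) (fun y hy => ?_)
    ⟨x, mem_ball_self hδ, hAU hx⟩
  by_contra hn
  rw [mem_union, not_or, notMem_compl_iff] at hn
  have hyf : y ∈ frontier (U : Set X) := by
    rw [U.isOpen.frontier_eq]
    exact ⟨hn.2, hn.1⟩
  linarith [h x hx y hyf, mem_ball'.1 hy]

theorem isUBounded_of_ball_subset {X : Type*} [NormedAddCommGroup X] {U : Opens X} {A : Set X}
    (hb : Bornology.IsBounded A) {δ : ℝ} (hδ : 0 < δ)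
    (h : ∀ x ∈ A, ball x δ ⊆ (U : Set X)) : IsUBounded U A := by
  refine ⟨hb, fun x hx => h x hx (mem_ball_self hδ), δ, hδ, fun x hx y hy => ?_⟩
  by_contra! hlt
  rw [U.isOpen.frontier_eq] at hy
  exact hy.2 (h x hx (mem_ball'.2 hlt))

theorem isUBounded_top_iff {X : Type*} [NormedAddCommGroup X] {A : Set X} :
    IsUBounded (⊤ : Opens X) A ↔ Bornology.IsBounded A :=
  ⟨fun h => h.1, fun h => isUBounded_of_ball_subset h one_pos fun _ _ => by simp⟩

theorem smul_mem_of_balanced (hU : Balanced ℂ (U : Set X)) {t : ℂ} (ht : ‖t‖ ≤ 1) {x : X}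
    (hx : x ∈ U) : t • x ∈ U :=
  hU t ht (smul_mem_smul_set hx)

theorem ball_smul_subset_of_balanced (hU : Balanced ℂ (U : Set X)) {t : ℂ} (ht : ‖t‖ ≤ 1)
    (ht0 : t ≠ 0) {x : X} {δ : ℝ} (h : ball x δ ⊆ (U : Set X)) :
    ball (t • x) (‖t‖ * δ) ⊆ (U : Set X) := by
  rw [← _root_.smul_ball ht0]
  rintro _ ⟨y, hy, rfl⟩
  exact smul_mem_of_balanced hU ht (h hy)

/-- In a balanced open set, the balanced hull of a slight dilation of a `U`-bounded set is
`U`-bounded. -/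
theorem IsUBounded.exists_dilation (hU : Balanced ℂ (U : Set X)) (h0 : (0 : X) ∈ U)
    (hA : IsUBounded U A) :
    ∃ R > 1, IsUBounded U {y | ∃ t : ℂ, ‖t‖ ≤ R ∧ ∃ a ∈ A, y = t • a} := by
  obtain ⟨δ, hδ, hball⟩ := hA.exists_ball_subset
  obtain ⟨M, hM, hAM⟩ := hA.1.exists_pos_norm_le
  obtain ⟨ρ, hρ, hρU⟩ := Metric.isOpen_iff.1 U.isOpen 0 h0
  -- There are three ranges of `‖t‖`, one for each radius in the minimum below. Under `s`, the point
  -- `t • a` has norm at most `ρ / 2`. Between `s` and `1`, balancedness carries `ball a δ` to a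
  -- ball of radius at least `s * δ` inside `U`. Between `1` and `R`, the point is within `δ / 2` of
  -- `(t / ‖t‖) • a`, whose `δ`-ball lies in `U`.
  have hs : 0 < ρ / (2 * M) := by positivity
  set s := ρ / (2 * M) with hsdef
  have hq : 0 < δ / (2 * M) := by positivity
  set R := 1 + δ / (2 * M) with hRdef
  refine ⟨R, by linarith, isUBounded_of_ball_subset (δ := min (ρ / 2) (min (s * δ) (δ / 2))) ?_
    (by positivity) ?_⟩
  · refine isBounded_iff_forall_norm_le.2 ⟨R * M, ?_⟩
    rintro _ ⟨t, ht, a, ha, rfl⟩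
    rw [norm_smul]
    gcongr
    exact hAM a ha
  · rintro _ ⟨t, ht, a, ha, rfl⟩
    rcases lt_or_ge ‖t‖ s with hts | hts
    · refine (ball_subset_ball' ?_).trans hρU
      have h1 : ‖t‖ * ‖a‖ ≤ s * M := by
        gcongr
        exact hAM a ha
      have h2 : s * M = ρ / 2 := by rw [hsdef]; field_simp
      rw [dist_zero_right, norm_smul]
      linarith [min_le_left (ρ / 2) (min (s * δ) (δ / 2))]
    · have ht0 : t ≠ 0 := norm_pos_iff.1 (hs.trans_le hts)
      have htp : 0 < ‖t‖ := norm_pos_iff.2 ht0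
      rcases le_or_gt ‖t‖ 1 with ht1 | ht1
      · refine (ball_subset_ball ?_).trans (ball_smul_subset_of_balanced hU ht1 ht0 (hball a ha))
        exact (min_le_right _ _).trans ((min_le_left _ _).trans (by gcongr))
      · set u : ℂ := t / ‖t‖
        have hu : ‖u‖ = 1 := by simp [u, htp.ne']
        have hu0 : u ≠ 0 := norm_pos_iff.1 (by rw [hu]; exact one_pos)
        have htu : t - u = ((‖t‖ - 1 : ℝ) : ℂ) * u := by
          have : (‖t‖ : ℂ) ≠ 0 := by exact_mod_cast htp.ne'
          simp only [u]
          push_cast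
          field_simp
        refine (ball_subset_ball' ?_).trans
          (ball_smul_subset_of_balanced hU hu.le hu0 (hball a ha))
        rw [dist_eq_norm, ← sub_smul, htu, norm_smul, norm_mul, hu, mul_one, one_mul,
          Complex.norm_of_nonneg (by linarith)]
        have h1 : (‖t‖ - 1) * ‖a‖ ≤ δ / (2 * M) * M := by
          gcongr
          · linarith
          · exact hAM a ha
        have h2 : δ / (2 * M) * M = δ / 2 := by field_simp
        linarith [min_le_right (ρ / 2) (min (s * δ) (δ / 2)), min_le_right (s * δ) (δ / 2)]

/-! ### Approximation by entire functions and transfer of characters -/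

/-- An entire function which is bounded on bounded sets, as an element of `H_b(X)`. -/
noncomputable def Hb.ofEntire (g : X → ℂ) (hg : Differentiable ℂ g)
    (hb : ∀ M : ℝ, ∃ C : ℝ, ∀ x : X, ‖x‖ ≤ M → ‖g x‖ ≤ C) : Hb (⊤ : Opens X) :=
  ⟨fun x => g x, ⟨g, hg.differentiableOn, fun _ => rfl⟩, fun B hB => by
    obtain ⟨M, hM⟩ := hB.1.exists_norm_le
    obtain ⟨C, hC⟩ := hb M
    exact ⟨C, fun x hx => hC x (hM x hx)⟩⟩

/-- Restriction `H_b(X) → H_b(U)`. -/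
noncomputable def Hb.restrict (U : Opens X) : Hb (⊤ : Opens X) →ₐ[ℂ] Hb U where
  toFun f := ⟨fun x => f ⟨x, trivial⟩, by
    obtain ⟨⟨g, hg, hfg⟩, hb⟩ := f.2
    refine ⟨⟨g, hg.mono (subset_univ _), fun x => hfg _⟩, fun B hB => ?_⟩
    obtain ⟨C, hC⟩ := hb B (isUBounded_top_iff.2 hB.1)
    exact ⟨C, fun x hx => hC _ hx⟩⟩
  map_one' := rfl
  map_mul' _ _ := rfl
  map_zero' := rfl
  map_add' _ _ := rfl
  commutes' _ := rfl

theorem Hb.restrict_apply (f : Hb (⊤ : Opens X)) (x : U) :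
    Hb.restrict U f x = f ⟨x, trivial⟩ := rfl

theorem supNormOn_restrict_le (f : Hb (⊤ : Opens X)) :
    supNormOn A (Hb.restrict U f) ≤ supNormOn A f :=
  supNormOn_le fun x hx => enorm_le_supNormOn f (x := ⟨x, trivial⟩) hx

theorem supNormOn_le_restrict (hA : A ⊆ U) (f : Hb (⊤ : Opens X)) :
    supNormOn A f ≤ supNormOn A (Hb.restrict U f) :=
  supNormOn_le fun x hx => enorm_le_supNormOn (Hb.restrict U f) (x := ⟨x, hA hx⟩) hx

/-- On a `U`-bounded subset of a balanced open set `U`, functions in `H_b(U)` are uniform limits of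
functions in `H_b(X)`, namely of their Taylor polynomials at `0`. -/
theorem exists_entire_approx (hU : Balanced ℂ (U : Set X)) (h0 : (0 : X) ∈ U)
    (hA : IsUBounded U A) (f : Hb U) : ∃ h : ℕ → Hb (⊤ : Opens X),
      Tendsto (fun n => supNormOn A (f - Hb.restrict U (h n))) atTop (𝓝 0) := by
  obtain ⟨R, hR, hB⟩ := hA.exists_dilation hU h0
  obtain ⟨⟨g, hg, hfg⟩, hb⟩ := f.2
  obtain ⟨C, hC⟩ := hb _ hB
  have hR0 : 0 < R := one_pos.trans hR
  let h : ℕ → Hb (⊤ : Opens X) := fun n =>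
    ∑ k ∈ Finset.range n, Hb.ofEntire (taylorCoeff g k)
      (differentiable_taylorCoeff U.isOpen h0 hg k)
      (exists_norm_taylorCoeff_le U.isOpen h0 hg k)
  have hh : ∀ n (x : (⊤ : Opens X)), h n x = ∑ k ∈ Finset.range n, taylorCoeff g k x := by
    intro n x
    induction n with
    | zero => rfl
    | succ n ih =>
      simp only [h, Finset.sum_range_succ] at ih ⊢
      rw [Hb.add_apply, ih]
      rfl
  refine ⟨h, ?_⟩
  have hlim : Tendsto (fun n : ℕ => ENNReal.ofReal (C * (1 / R) ^ n / (1 - 1 / R))) atTop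
      (𝓝 0) := by
    have h1 := tendsto_pow_atTop_nhds_zero_of_lt_one (r := 1 / R) (by positivity)
      ((div_lt_one hR0).2 hR)
    have h2 := ENNReal.tendsto_ofReal ((h1.const_mul C).div_const (1 - 1 / R))
    simpa using h2
  refine tendsto_of_tendsto_of_tendsto_of_le_of_le tendsto_const_nhds hlim (fun _ => zero_le)
    fun n => supNormOn_le fun x hx => ?_
  have hmem : ∀ t : ℂ, ‖t‖ ≤ R → t • (x : X) ∈ (U : Set X) := fun t ht =>
    hB.2.1 ⟨t, ht, x, hx, rfl⟩
  have hbd : ∀ t : ℂ, ‖t‖ ≤ R → ‖g (t • (x : X))‖ ≤ C := fun t ht => by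
    have := hC ⟨_, hmem t ht⟩ ⟨t, ht, x, hx, rfl⟩
    rwa [hfg] at this
  -- As `R > 1`, the value `t = 1` is strictly inside the disc, which gives the ratio `1 / R`
  -- uniformly in `x ∈ A`.
  have hrem := norm_sub_sum_taylorCoeff_le hg hR0 hmem hbd (t := 1) (by simpa using hR) n
  rw [Hb.sub_apply, Hb.restrict_apply, hh, hfg x, ← ofReal_norm]
  refine ENNReal.ofReal_le_ofReal ?_
  simpa using hrem

/-- A homomorphism on `H_b(X)` which is bounded by the supremum over `A` extends to `H_b(U)`. -/
theorem exists_algHom_extension (hU : Balanced ℂ (U : Set X)) (h0 : (0 : X) ∈ U)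
    (hA : IsUBounded U A) (φ : Hb (⊤ : Opens X) →ₐ[ℂ] ℂ) (hφ : ∀ g, ‖φ g‖ₑ ≤ supNormOn A g) :
    ∃ ψ : Hb U →ₐ[ℂ] ℂ, (∀ f, ψ (Hb.restrict U f) = φ f) ∧ ∀ g, ‖ψ g‖ₑ ≤ supNormOn A g := by
  -- This estimate makes the values of `φ` along approximating sequences Cauchy, with a limit
  -- independent of the sequence.
  have key : ∀ (f : Hb U) (a b : Hb (⊤ : Opens X)), edist (φ a) (φ b) ≤
      supNormOn A (f - Hb.restrict U a) + supNormOn A (f - Hb.restrict U b) := by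
    intro f a b
    rw [edist_comm, edist_eq_enorm_sub, ← map_sub]
    refine (hφ _).trans ((supNormOn_le_restrict hA.2.1 _).trans ?_)
    have : Hb.restrict U (b - a) = (f - Hb.restrict U a) - (f - Hb.restrict U b) := by
      rw [map_sub]; ring
    rw [this]
    exact supNormOn_sub_le _ _
  -- This is the graph of the extension by continuity for the seminorm `sup_A`.
  let R : Hb U → ℂ → Prop := fun f c => ∃ h : ℕ → Hb (⊤ : Opens X),
    Tendsto (fun n => supNormOn A (f - Hb.restrict U (h n))) atTop (𝓝 0) ∧
      Tendsto (fun n => φ (h n)) atTop (𝓝 c)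
  have hconst : ∀ f, R (Hb.restrict U f) (φ f) := fun f => ⟨fun _ => f, by
    have h00 : supNormOn A (Hb.restrict U f - Hb.restrict U f) = 0 :=
      le_antisymm (supNormOn_le fun x _ => by rw [Hb.sub_apply, sub_self, enorm_zero]) zero_le
    simp only [h00]
    exact tendsto_const_nhds, tendsto_const_nhds⟩
  have huniq : ∀ f c c', R f c → R f c' → c = c' := by
    rintro f c c' ⟨h, h1, h2⟩ ⟨h', h1', h2'⟩
    have hlim : Tendsto (fun n => edist (φ (h n)) (φ (h' n))) atTop (𝓝 0) :=
      tendsto_of_tendsto_of_tendsto_of_le_of_le tendsto_const_nhds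
        (by simpa using h1.add h1') (fun _ => zero_le) fun n => key f (h n) (h' n)
    exact edist_eq_zero.1 (tendsto_nhds_unique (h2.edist h2') hlim)
  have hψ : ∃ ψ : Hb U →ₐ[ℂ] ℂ, ∀ f, R f (ψ f) := by
    refine exists_algHom_of_rel ?_ huniq ?_ ?_ ?_
    · intro f
      obtain ⟨h, h1⟩ := exists_entire_approx hU h0 hA f
      have hc : CauchySeq fun n => φ (h n) := by
        rw [EMetric.cauchySeq_iff]
        intro ε hε
        obtain ⟨N, hN⟩ := eventually_atTop.1
          (h1.eventually_lt_const (ENNReal.half_pos hε.ne'))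
        refine ⟨N, fun m hm n hn => (key f _ _).trans_lt ?_⟩
        exact (ENNReal.add_lt_add (hN m hm) (hN n hn)).trans_eq (ENNReal.add_halves ε)
      obtain ⟨c, hc⟩ := cauchySeq_tendsto_of_complete hc
      exact ⟨c, h, h1, hc⟩
    · rintro f f' c c' ⟨h, h1, h2⟩ ⟨h', h1', h2'⟩
      refine ⟨fun n => h n + h' n, ?_, by simpa using h2.add h2'⟩
      refine tendsto_of_tendsto_of_tendsto_of_le_of_le tendsto_const_nhds
        (by simpa using h1.add h1') (fun _ => zero_le) fun n => ?_
      refine le_trans (le_of_eq ?_) (supNormOn_add_le _ _)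
      rw [map_add, add_sub_add_comm]
    · rintro f f' c c' ⟨h, h1, h2⟩ ⟨h', h1', h2'⟩
      refine ⟨fun n => h n * h' n, ?_, by simpa using h2.mul h2'⟩
      have hlim : Tendsto (fun n => supNormOn A f * supNormOn A (f' - Hb.restrict U (h' n)) +
          supNormOn A (f - Hb.restrict U (h n)) *
            (supNormOn A f' + supNormOn A (f' - Hb.restrict U (h' n)))) atTop (𝓝 0) := by
        have e1 := ENNReal.Tendsto.const_mul h1' (Or.inr (supNormOn_ne_top hA f))
        have e2 := ENNReal.Tendsto.mul h1 (Or.inr (by simpa using supNormOn_ne_top hA f'))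
          (h1'.const_add (supNormOn A f')) (Or.inr ENNReal.zero_ne_top)
        simpa using e1.add e2
      refine tendsto_of_tendsto_of_tendsto_of_le_of_le tendsto_const_nhds hlim
        (fun _ => zero_le) fun n => ?_
      -- The second approximant is written as `f'` minus its error, so that its supremum over `A` is
      -- bounded by finite quantities attached to `f'` plus a null term.
      have heq : f * f' - Hb.restrict U (h n * h' n) = f * (f' - Hb.restrict U (h' n)) +
          (f - Hb.restrict U (h n)) * (f' - (f' - Hb.restrict U (h' n))) := by
        rw [map_mul]; ring
      calc _ = _ := congrArg (supNormOn A) heq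
        _ ≤ _ := supNormOn_add_le _ _
        _ ≤ _ := add_le_add (supNormOn_mul_le _ _) ((supNormOn_mul_le _ _).trans
          (mul_le_mul' le_rfl (supNormOn_sub_le _ _)))
    · intro c
      have := hconst (algebraMap ℂ _ c)
      simpa using this
  obtain ⟨ψ, hψ⟩ := hψ
  refine ⟨ψ, fun f => huniq _ _ _ (hψ _) (hconst f), fun g => ?_⟩
  obtain ⟨h, h1, h2⟩ := hψ g
  have h3 : Tendsto (fun n => supNormOn A g + supNormOn A (g - Hb.restrict U (h n))) atTop
      (𝓝 (supNormOn A g)) := by simpa using h1.const_add (supNormOn A g)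
  refine le_of_tendsto_of_tendsto' h2.enorm h3 fun n => ?_
  refine (hφ _).trans ((supNormOn_le_restrict hA.2.1 _).trans ?_)
  refine le_trans (le_of_eq ?_) (supNormOn_sub_le g (g - Hb.restrict U (h n)))
  rw [sub_sub_cancel]

/-- The cluster value property of a `U`-bounded set `A` does not depend on the balanced open
set `U`. -/
theorem clusterValueEqOn_iff_top (hU : Balanced ℂ (U : Set X)) (h0 : (0 : X) ∈ U)
    (hA : IsUBounded U A) : ClusterValueEqOn U A ↔ ClusterValueEqOn (⊤ : Opens X) A := by
  rw [clusterValueEqOn_iff hA, clusterValueEqOn_iff (isUBounded_top_iff.2 hA.1)]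
  constructor
  · intro H f z φ hφz hφ
    obtain ⟨ψ, hψ, hψA⟩ := exists_algHom_extension hU h0 hA φ hφ
    -- The restriction of `f` equals `f` on `A`, so the approximation is exact and only the ambient
    -- open set changes.
    refine mem_clusterSet_of_forall_approx (V := U) (subset_univ A) fun ε _ =>
      ⟨Hb.restrict U f, φ f, ?_, by simp, fun x y hxy _ => ?_⟩
    · rw [← hψ f]
      exact H _ z ψ (fun ξ => (hψ (Hb.ofDual ⊤ ξ)).trans (hφz ξ)) hψA
    · rw [Hb.restrict_apply, show (⟨y, trivial⟩ : (⊤ : Opens X)) = x from Subtype.ext hxy.symm]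
      simp
  · intro H f z φ hφz hφ
    -- The hypothesis gives cluster values of the approximants `h n`. They are close to `φ f`
    -- because `φ` is dominated by the supremum over `A`.
    obtain ⟨h, hh⟩ := exists_entire_approx hU h0 hA f
    refine mem_clusterSet_of_forall_approx (V := ⊤) hA.2.1 fun ε hε => ?_
    obtain ⟨n, hn⟩ := (hh.eventually_lt_const hε).exists
    refine ⟨h n, φ (Hb.restrict U (h n)), ?_, ?_, fun x y hxy hx => ?_⟩
    · exact H (h n) z (φ.comp (Hb.restrict U)) hφz
        fun g => (hφ _).trans (supNormOn_restrict_le g)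
    · rw [edist_comm, edist_eq_enorm_sub, ← map_sub]
      exact (hφ _).trans hn.le
    · rw [edist_eq_enorm_sub, show y = ⟨x, trivial⟩ from Subtype.ext hxy.symm]
      exact (enorm_le_supNormOn (f - Hb.restrict U (h n)) hx).trans hn.le

/-! ### Dilations and the reduction to the whole space -/

/-- The composition with a dilation, as an endomorphism of `H_b(X)`. -/
noncomputable def Hb.dilate (c : ℂ) : Hb (⊤ : Opens X) →ₐ[ℂ] Hb (⊤ : Opens X) where
  toFun f := ⟨fun x => f ⟨c • (x : X), trivial⟩, by
    obtain ⟨⟨g, hg, hfg⟩, hb⟩ := f.2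
    refine ⟨⟨fun x => g (c • x), hg.comp (by fun_prop) fun _ _ => trivial, fun x => hfg _⟩,
      fun B hB => ?_⟩
    obtain ⟨C, hC⟩ := hb ((fun x : X => c • x) '' B) (isUBounded_top_iff.2 (hB.1.smul₀ c))
    exact ⟨C, fun x hx => hC _ ⟨x, hx, rfl⟩⟩⟩
  map_one' := rfl
  map_mul' _ _ := rfl
  map_zero' := rfl
  map_add' _ _ := rfl
  commutes' _ := rfl

theorem Hb.dilate_apply (c : ℂ) (f : Hb (⊤ : Opens X)) (x : (⊤ : Opens X)) :
    Hb.dilate c f x = f ⟨c • (x : X), trivial⟩ := rfl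

/-- If `φ` lies over `z` and is dominated over `A`, then `φ` composed with the dilation lies over `c
• z` and is dominated over `c • A`. Its cluster filter is brought back to `A` by `c⁻¹`. -/
theorem ClusterValueEqOn.of_smul {c : ℂ} (hc : c ≠ 0) (hA : Bornology.IsBounded A)
    (H : ClusterValueEqOn (⊤ : Opens X) ((fun x : X => c • x) '' A)) :
    ClusterValueEqOn (⊤ : Opens X) A := by
  replace H := (clusterValueEqOn_iff (isUBounded_top_iff.2 (hA.smul₀ c))).1 H
  rw [clusterValueEqOn_iff (isUBounded_top_iff.2 hA)]
  intro f z φ hφz hφ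
  have hinv : Hb.dilate c (Hb.dilate c⁻¹ f) = f := Hb.ext fun x => by
    simp only [Hb.dilate_apply, inv_smul_smul₀ hc]
  have h1 := H (Hb.dilate c⁻¹ f) (c • z) (φ.comp (Hb.dilate c)) (fun ξ => ?_) fun g => ?_
  · rw [AlgHom.comp_apply, hinv] at h1
    obtain ⟨F, hF, hFA, hFz, hFf⟩ := mem_clusterSet_iff.1 h1
    refine mem_clusterSet_iff.2 ⟨F.map fun x : (⊤ : Opens X) => ⟨c⁻¹ • (x : X), trivial⟩,
      inferInstance, ?_, fun ξ => ?_, hFf⟩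
    · refine eventually_map.2 (hFA.mono ?_)
      rintro x ⟨a, ha, hx⟩
      simpa [← hx, inv_smul_smul₀ hc] using ha
    · have := (hFz ξ).const_mul c⁻¹
      simpa [tendsto_map'_iff, Function.comp_def, inv_mul_cancel_left₀ hc] using this
  · have : Hb.dilate c (Hb.ofDual ⊤ ξ) = c • Hb.ofDual ⊤ ξ := Hb.ext fun x => ξ.map_smul c x
    rw [AlgHom.comp_apply, this, map_smul, hφz]
    rfl
  · exact (hφ _).trans (supNormOn_le fun x hx => enorm_le_supNormOn g
      (x := ⟨c • (x : X), trivial⟩) ⟨x, hx, rfl⟩)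

theorem exists_smul_isUBounded (h0 : (0 : X) ∈ U) (hA : Bornology.IsBounded A) :
    ∃ r : ℝ, 0 < r ∧ IsUBounded U ((fun x : X => (r : ℂ) • x) '' A) := by
  obtain ⟨ρ, hρ, hρU⟩ := Metric.isOpen_iff.1 U.isOpen 0 h0
  obtain ⟨M, hM, hAM⟩ := hA.exists_pos_norm_le
  -- This factor shrinks `A` to norm at most `ρ / 2`, leaving a margin `ρ / 2` inside `ball 0 ρ`.
  refine ⟨ρ / (2 * M), by positivity,
    isUBounded_of_ball_subset (hA.smul₀ _) (half_pos hρ) ?_⟩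
  rintro _ ⟨a, ha, rfl⟩
  refine (ball_subset_ball' ?_).trans hρU
  rw [dist_zero_right, norm_smul, Complex.norm_of_nonneg (by positivity)]
  have h1 : ρ / (2 * M) * ‖a‖ ≤ ρ / (2 * M) * M := by
    gcongr
    exact hAM a ha
  have h2 : ρ / (2 * M) * M = ρ / 2 := by field_simp
  linarith

theorem zero_mem_of_balanced (hne : (U : Set X).Nonempty) (hU : Balanced ℂ (U : Set X)) :
    (0 : X) ∈ U := by
  obtain ⟨x, hx⟩ := hne
  simpa using smul_mem_of_balanced hU (t := 0) (by simp) hx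

/-- For families that are stable under dilations, the Cluster Value Theorem does not depend on the
nonempty balanced open set. -/
theorem clusterValueTheoremFor_iff_top {𝒜 : Set (Set X)} (h𝒜 : DilationStable 𝒜)
    (hne : (U : Set X).Nonempty) (hU : Balanced ℂ (U : Set X)) :
    ClusterValueTheoremFor 𝒜 U ↔ ClusterValueTheoremFor 𝒜 (⊤ : Opens X) := by
  have h0 := zero_mem_of_balanced hne hU
  constructor
  · intro H A hA𝒜 hA
    obtain ⟨r, hr, hrA⟩ := exists_smul_isUBounded h0 hA.1
    exact ClusterValueEqOn.of_smul (by exact_mod_cast hr.ne') hA.1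
      ((clusterValueEqOn_iff_top hU h0 hrA).1 (H _ (h𝒜 A hA𝒜 r hr) hrA))
  · intro H A hA𝒜 hA
    exact (clusterValueEqOn_iff_top hU h0 hA).2 (H A hA𝒜 (isUBounded_top_iff.2 hA.1))

theorem clusterValueTheoremFor_univ :
    ClusterValueTheoremFor (univ : Set (Set X)) U ↔ ClusterValueTheorem U := by
  simp [ClusterValueTheoremFor, ClusterValueTheorem]

theorem clusterValueTheoremFor_top_iff {𝒜 : Set (Set X)} (h𝒜 : DilationStable 𝒜) :
    (ClusterValueTheoremFor 𝒜 (⊤ : Opens X) ↔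
        ∀ U : Opens X, (U : Set X).Nonempty → Balanced ℂ (U : Set X) →
          ClusterValueTheoremFor 𝒜 U) ∧
      (ClusterValueTheoremFor 𝒜 (⊤ : Opens X) ↔
        ∃ U : Opens X, (U : Set X).Nonempty ∧ Balanced ℂ (U : Set X) ∧
          ClusterValueTheoremFor 𝒜 U) := by
  have htop : ((⊤ : Opens X) : Set X).Nonempty ∧ Balanced ℂ ((⊤ : Opens X) : Set X) :=
    ⟨⟨0, trivial⟩, fun _ _ => subset_univ _⟩
  exact ⟨⟨fun H U hne hU => (clusterValueTheoremFor_iff_top h𝒜 hne hU).2 H,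
      fun H => H ⊤ htop.1 htop.2⟩,
    fun H => ⟨⊤, htop.1, htop.2, H⟩,
    fun ⟨_, hne, hU, H⟩ => (clusterValueTheoremFor_iff_top h𝒜 hne hU).1 H⟩

end Balanced

end ClusterValue

theorem theorem2p6 {X : Type*} [NormedAddCommGroup X] [NormedSpace ℂ X] [CompleteSpace X] :
    ((ClusterValue.ClusterValueTheorem (⊤ : TopologicalSpace.Opens X) ↔
        ∀ U : TopologicalSpace.Opens X, (U : Set X).Nonempty → Balanced ℂ (U : Set X) →
          ClusterValue.ClusterValueTheorem U) ∧
      (ClusterValue.ClusterValueTheorem (⊤ : TopologicalSpace.Opens X) ↔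
        ∃ U : TopologicalSpace.Opens X, (U : Set X).Nonempty ∧ Balanced ℂ (U : Set X) ∧
          ClusterValue.ClusterValueTheorem U)) ∧
    ∀ 𝒜 : Set (Set X), ClusterValue.DilationStable 𝒜 →
      (ClusterValue.ClusterValueTheoremFor 𝒜 (⊤ : TopologicalSpace.Opens X) ↔
        ∀ U : TopologicalSpace.Opens X, (U : Set X).Nonempty → Balanced ℂ (U : Set X) →
          ClusterValue.ClusterValueTheoremFor 𝒜 U) ∧
      (ClusterValue.ClusterValueTheoremFor 𝒜 (⊤ : TopologicalSpace.Opens X) ↔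
        ∃ U : TopologicalSpace.Opens X, (U : Set X).Nonempty ∧ Balanced ℂ (U : Set X) ∧
          ClusterValue.ClusterValueTheoremFor 𝒜 U) := by
  refine ⟨?_, fun 𝒜 h𝒜 => ClusterValue.clusterValueTheoremFor_top_iff h𝒜⟩
  have h := ClusterValue.clusterValueTheoremFor_top_iff (X := X) (𝒜 := Set.univ)
    fun _ _ _ _ => trivial
  simpa only [ClusterValue.clusterValueTheoremFor_univ] using h
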